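/- Let $\mathcal A$ be a commutative, associative, unital algebra of finite dimension over $\mathbb R$, with multiplication $\star$, equipped with any vector-space norm. Let $U\subseteq\mathcal A$ be an open, simply connected set, and let $f:U\to\mathcal A$ be continuously differentiable in the real Fréchet sense. Let $f\star d\zeta$ denote the $\mathcal A$-valued one-form on $U$ whose value at $p\in U$ is the real linear map $v\mapsto f(p)\star v$; equivalently, $f\star d\zeta=\sum_j (f\star v_j)\,dx_j$ for any basis $v_1,\dots,v_n$ of $\mathcal A$ with coordinates $x_1,\dots,x_n$. Then $f\star d\zeta$ is exact on $U$ (that is, there is a function $\phi:U\to\mathcal A$, differentiable in the real Fréchet sense, with $d\phi=f\star d\zeta$ on $U$) if and only if $f$ is $\mathcal A$-differentiable on $U$ (that is, at every $p\in U$ the real Fréchet differential $d_pf:\mathcal A\to\mathcal A$ exists and satisfies $d_pf(v\star w)=d_pf(v)\star w$ for all $v,w\in\mathcal A$). -/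

import Mathlib

/-- A real associative unital algebra `A` (not necessarily commutative) carrying a norm which makes
its underlying real vector space a normed space. No relation between the norm and the
multiplication is required (in particular the norm need not be submultiplicative). -/
class RealNormAlgebra (A : Type*) extends Norm A, Ring A, MetricSpace A, Algebra ℝ A where
  /-- The distance is the one induced by the norm. -/
  dist_eq_norm_neg_add : ∀ x y : A, dist x y = ‖-x + y‖
  /-- Homogeneity of the norm (the opposite inequality is a consequence). -/
  norm_smul_le_mul : ∀ (c : ℝ) (x : A), ‖c • x‖ ≤ ‖c‖ * ‖x‖

namespace RealNormAlgebra

instance (priority := 100) instNormedAddCommGroup (A : Type*) [h : RealNormAlgebra A] : NormedAddCommGroup A :=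
  { h with dist_eq := h.dist_eq_norm_neg_add }

instance (priority := 100) instNormedSpace (A : Type*) [h : RealNormAlgebra A] : NormedSpace ℝ A :=
  { h.toAlgebra.toModule with norm_smul_le := h.norm_smul_le_mul }

section Definitions

variable {A : Type*} [RealNormAlgebra A] [FiniteDimensional ℝ A]

/-- The set of right-`A`-linear maps: the `ℝ`-linear `T : A → A` with
`T (x * y) = T x * y` for all `x y`. -/
def rightLinearMaps (A : Type*) [RealNormAlgebra A] : Set (A →ₗ[ℝ] A) :=
  {T | ∀ x y : A, T (x * y) = T x * y}

/-- `f` is `A`-differentiable at `p`: it has a (real) Fréchet differential at `p` which is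
right-`A`-linear. (`A` is finite-dimensional, so all linear maps are continuous.) -/
def AlgDifferentiableAt (f : A → A) (p : A) : Prop :=
  ∃ T ∈ rightLinearMaps A, HasFDerivAt f (LinearMap.toContinuousLinearMap T) p

/-- `f` is `A`-differentiable on `U`. -/
def AlgDifferentiableOn (f : A → A) (U : Set A) : Prop :=
  ∀ p ∈ U, AlgDifferentiableAt f p

/-- An `A`-valued one-form `α` on `A` is a field of real linear maps `α p : A → A`. It is exact
on `U` if it is the differential of a function on `U`. -/
def ExactOn (α : A → A →L[ℝ] A) (U : Set A) : Prop :=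
  ∃ φ : A → A, ∀ p ∈ U, HasFDerivAt φ (α p) p

/-- The one-form `dζ`, the differential of the identity function `ζ`. -/
def dZeta (A : Type*) [RealNormAlgebra A] : A → A →L[ℝ] A :=
  fun _ => ContinuousLinearMap.id ℝ A

/-- The product `f ⋆ α` of an `A`-valued function and an `A`-valued one-form:
`(f ⋆ α)_p (v) = f p * α_p v`. -/
noncomputable def starForm (f : A → A) (α : A → A →L[ℝ] A) : A → A →L[ℝ] A :=
  fun p => (LinearMap.toContinuousLinearMap (LinearMap.mulLeft ℝ (f p))).comp (α p)

theorem starForm_dZeta_apply (f : A → A) (p v : A) : starForm f (dZeta A) p v = f p * v := rfl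

end Definitions

/-- In coordinates, `dζ = ∑ j, v_j dx_j` for every basis `v` of `A`. -/
theorem dZeta_apply_eq_sum {A : Type*} [RealNormAlgebra A] {ι : Type*} [Fintype ι] (v : Module.Basis ι ℝ A) (p h : A) :
    dZeta A p h = ∑ j, v.coord j h • v j := by
  simp [dZeta]


end RealNormAlgebra

/-!
Both directions compare `f ⋆ dζ` with its derivative. At `p ∈ U` the one-form `f ⋆ dζ`, seen as a
map into `A →L[ℝ] A`, has derivative `(v, w) ↦ d_p f v * w`
(`RealNormAlgebra.hasFDerivAt_starForm_dZeta`), so it is closed on `U` exactly when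
`d_p f v * w = d_p f w * v` for all `p ∈ U` and all `v`, `w`. For commutative `A` this symmetry is
the same as right-linearity of `d_p f`: putting `w = 1` gives `d_p f v = d_p f 1 * v`
(`RealNormAlgebra.mem_rightLinearMaps_iff_symmetric`).

An exact form with differentiable coefficients is closed by the symmetry of second derivatives.
The converse is the Poincaré lemma on a simply connected open set
(`exists_hasFDerivAt_of_isSimplyConnected`). On balls it is the convex case known to Mathlib. The
local primitives are determined up to locally constant functions, so the pairs
(point, value of a primitive) form a covering space of `U` whose fibre is discrete. As `U` is
simply connected, the identity of `U` lifts to this covering, and such a section is a global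
primitive (`exists_forall_eventually_sub_eq_of_simplyConnected`).
-/

open Topology

/-! ### Gluing functions that agree up to locally constant differences -/

/-- On a simply connected space, a `0`-cochain of functions `P i` on an open cover `B i` whose
differences are locally constant can be corrected, by locally constant functions on the `B i`, to a
global function. The topology of `F` plays no role: "locally constant" is meant literally. -/
theorem exists_forall_eventually_sub_eq_of_simplyConnected {X ι F : Type*} [TopologicalSpace X]
    [SimplyConnectedSpace X] [LocallyPathConnectedSpace X] [AddCommGroup F]
    (B : ι → Set X) (hB : ∀ i, IsOpen (B i)) (hcover : ∀ x, ∃ i, x ∈ B i) (P : ι → X → F)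
    (hP : ∀ i j, ∀ x ∈ B i ∩ B j, ∀ᶠ y in 𝓝 x, P i y - P j y = P i x - P j x) :
    ∃ φ : X → F, ∀ i, ∀ x ∈ B i, ∀ᶠ y in 𝓝 x, φ y - P i y = φ x - P i x := by
  choose idx hidx using hcover
  let _ : TopologicalSpace F := ⊥
  have : DiscreteTopology F := ⟨rfl⟩
  -- The coordinate `v` over `x` in the chart `i` encodes the value `v + P i x` at `x`.
  let Z : FiberBundleCore ι X F :=
    { baseSet := B
      isOpen_baseSet := hB
      indexAt := idx
      mem_baseSet_at := hidx
      coordChange := fun i j x v ↦ v + (P i x - P j x)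
      coordChange_self := by simp
      continuousOn_coordChange := by
        rintro i j ⟨x, v⟩ ⟨hx, -⟩
        have h1 : ContinuousAt (fun p : X × F ↦ P i p.1 - P j p.1) (x, v) :=
          (continuousAt_const (y := P i x - P j x)).congr
            ((continuousAt_fst.eventually (hP i j x hx)).mono fun _ h ↦ h.symm)
        exact (continuousAt_snd.add h1).continuousWithinAt
      coordChange_comp := by
        intro i j k x _ v
        abel }
  have hcov : IsCoveringMap (Bundle.TotalSpace.proj : Bundle.TotalSpace F Z.Fiber → X) :=
    FiberBundle.isCoveringMap
  obtain ⟨x₀⟩ : Nonempty X := inferInstance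
  obtain ⟨s, ⟨-, hs⟩, -⟩ := hcov.existsUnique_continuousMap_lifts (ContinuousMap.id X) x₀
    (⟨x₀, (0 : F)⟩ : Bundle.TotalSpace F Z.Fiber) rfl
  have hproj : ∀ x, (s x).proj = x := fun x ↦ congrFun hs x
  let v : X → F := fun x ↦ (s x).snd
  refine ⟨fun x ↦ v x + P (idx x) x, fun i x hx ↦ ?_⟩
  -- In the chart `i`, the section has coordinate `φ x - P i x`, which is continuous with values in
  -- a discrete space.
  have hcoord : ∀ y, (Z.localTriv i (s y)).2 = v y + P (idx y) y - P i y := by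
    intro y
    rw [Z.localTriv_apply, add_sub_assoc]
    change v y + (P (idx (s y).proj) (s y).proj - P i (s y).proj) = _
    rw [hproj]
  have hcont : ContinuousAt (fun y ↦ (Z.localTriv i (s y)).2) x := by
    refine continuousAt_snd.comp
      (ContinuousAt.comp (g := Z.localTriv i) ?_ s.continuous.continuousAt)
    refine (Z.localTriv i).continuousAt ?_
    rw [Z.mem_localTriv_source, ← Z.baseSet_at, hproj]
    exact hx
  rw [ContinuousAt, nhds_discrete F, Filter.tendsto_pure] at hcont
  filter_upwards [hcont] with y hy
  rw [← hcoord, ← hcoord, hy]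

/-! ### The Poincaré lemma on simply connected open sets -/

section Poincare

variable {E F : Type*} [NormedAddCommGroup E] [NormedSpace ℝ E] [NormedAddCommGroup F]
  [NormedSpace ℝ F]

/-- Two primitives of the same one-form differ by a locally constant function. -/
theorem eventually_sub_eq_sub_of_hasFDerivAt {ω : E → E →L[ℝ] F} {g h : E → F} {x : E}
    (hg : ∀ᶠ y in 𝓝 x, HasFDerivAt g (ω y) y) (hh : ∀ᶠ y in 𝓝 x, HasFDerivAt h (ω y) y) :
    ∀ᶠ y in 𝓝 x, g y - h y = g x - h x := by
  obtain ⟨ε, hε, hball⟩ := Metric.eventually_nhds_iff_ball.1 (hg.and hh)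
  have hd : ∀ y ∈ Metric.ball x ε, HasFDerivAt (g - h) (0 : E →L[ℝ] F) y := fun y hy ↦ by
    simpa using (hball y hy).1.sub (hball y hy).2
  filter_upwards [Metric.ball_mem_nhds x hε] with y hy
  exact Metric.isOpen_ball.is_const_of_fderiv_eq_zero (convex_ball x ε).isPreconnected
    (fun z hz ↦ (hd z hz).differentiableAt.differentiableWithinAt)
    (fun z hz ↦ (hd z hz).fderiv) hy (Metric.mem_ball_self hε)

/-- A closed one-form on a simply connected open set has a primitive. -/
theorem exists_hasFDerivAt_of_isSimplyConnected [CompleteSpace F] {U : Set E} (hUo : IsOpen U)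
    (hU : IsSimplyConnected U) {ω : E → E →L[ℝ] F} (hω : DifferentiableOn ℝ ω U)
    (hdω : ∀ a ∈ U, ∀ x y, fderiv ℝ ω a x y = fderiv ℝ ω a y x) :
    ∃ φ : E → F, ∀ a ∈ U, HasFDerivAt φ (ω a) a := by
  have := hU.simplyConnectedSpace
  have := hUo.locallyPathConnectedSpace
  have hloc : ∀ i : U, ∃ r > 0, Metric.ball (i : E) r ⊆ U := fun i ↦
    Metric.isOpen_iff.1 hUo i i.2
  choose r hr hrU using hloc
  have hprim : ∀ i : U, ∃ g : E → F, ∀ a ∈ Metric.ball (i : E) (r i), HasFDerivAt g (ω a) a :=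
    fun i ↦ (convex_ball _ _).exists_forall_hasFDerivAt_of_fderiv_symmetric Metric.isOpen_ball
      (hω.mono (hrU i)) fun a ha ↦ hdω a (hrU i ha)
  choose P hP using hprim
  have hP' : ∀ i : U, ∀ x ∈ Metric.ball (i : E) (r i), ∀ᶠ y in 𝓝 x, HasFDerivAt (P i) (ω y) y :=
    fun i x hx ↦ Filter.mem_of_superset (Metric.isOpen_ball.mem_nhds hx) (hP i)
  obtain ⟨φ, hφ⟩ := exists_forall_eventually_sub_eq_of_simplyConnected
    (fun i : U ↦ ((↑) : U → E) ⁻¹' Metric.ball (i : E) (r i))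
    (fun i ↦ Metric.isOpen_ball.preimage continuous_subtype_val)
    (fun x ↦ ⟨x, Metric.mem_ball_self (hr x)⟩) (fun i x ↦ P i x)
    (fun i j x hx ↦ continuous_subtype_val.continuousAt.eventually
      (eventually_sub_eq_sub_of_hasFDerivAt (hP' i x hx.1) (hP' j x hx.2)))
  refine ⟨Function.extend ((↑) : U → E) φ 0, fun a ha ↦ ?_⟩
  lift a to U using ha
  have hφa := hφ a a (Metric.mem_ball_self (hr a))
  refine ((hP a a (Metric.mem_ball_self (hr a))).add_const (φ a - P a a)).congr_of_eventuallyEq ?_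
  rw [Filter.EventuallyEq, ← map_nhds_subtype_coe_eq_nhds a.2 (hUo.mem_nhds a.2),
    Filter.eventually_map]
  filter_upwards [hφa] with y hy
  rw [Subtype.val_injective.extend_apply, ← hy]
  abel

end Poincare

/-! ### The form `f ⋆ dζ` and right-linear differentials -/

namespace RealNormAlgebra

variable {A : Type*} [RealNormAlgebra A]

/-- The derivative of `f ⋆ dζ`, as a map into `A →L[ℝ] A`, is `v ↦ (w ↦ T v * w)`, where `T` is the
derivative of `f`. -/
theorem hasFDerivAt_starForm_dZeta [FiniteDimensional ℝ A] {f : A → A} {T : A →L[ℝ] A} {p : A}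
    (hf : HasFDerivAt f T p) :
    ∃ T' : A →L[ℝ] A →L[ℝ] A, HasFDerivAt (starForm f (dZeta A)) T' p ∧
      ∀ v w, T' v w = T v * w := by
  -- Finite-dimensionality makes multiplication jointly continuous for an arbitrary norm.
  let M : A →L[ℝ] A →L[ℝ] A := LinearMap.toContinuousLinearMap
    (LinearMap.toContinuousLinearMap.toLinearMap ∘ₗ LinearMap.mul ℝ A)
  have hM : starForm f (dZeta A) = fun q ↦ M (f q) := by
    ext q v
    rfl
  refine ⟨M.comp T, ?_, fun v w ↦ rfl⟩
  rw [hM]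
  exact M.hasFDerivAt.comp p hf

/-- In a commutative algebra, right-linearity of `T` is symmetry of the bilinear map
`(v, w) ↦ T v * w`. -/
theorem mem_rightLinearMaps_iff_symmetric (hcomm : ∀ x y : A, x * y = y * x) (T : A →ₗ[ℝ] A) :
    T ∈ rightLinearMaps A ↔ ∀ v w : A, T v * w = T w * v := by
  refine ⟨fun hT v w ↦ by rw [← hT, ← hT, hcomm], fun hT v w ↦ ?_⟩
  have h1 : ∀ x, T x = T 1 * x := fun x ↦ by simpa using hT x 1
  rw [h1, h1 v, mul_assoc]

end RealNormAlgebra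

theorem mainTheorem10 {A : Type*} [RealNormAlgebra A] [FiniteDimensional ℝ A]
    (hcomm : ∀ x y : A, x * y = y * x)
    (U : Set A) (hUo : IsOpen U) (hU : IsSimplyConnected U)
    (f : A → A) (hf : ContDiffOn ℝ 1 f U) :
    RealNormAlgebra.ExactOn (RealNormAlgebra.starForm f (RealNormAlgebra.dZeta A)) U ↔
      RealNormAlgebra.AlgDifferentiableOn f U := by
  have hfd : ∀ p ∈ U, HasFDerivAt f (fderiv ℝ f p) p := fun p hp ↦
    ((hf.differentiableOn one_ne_zero).differentiableAt (hUo.mem_nhds hp)).hasFDerivAt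
  constructor
  · rintro ⟨φ, hφ⟩ p hp
    obtain ⟨T', hT', hT'mul⟩ := RealNormAlgebra.hasFDerivAt_starForm_dZeta (hfd p hp)
    refine ⟨(fderiv ℝ f p).toLinearMap, ?_, hfd p hp⟩
    rw [RealNormAlgebra.mem_rightLinearMaps_iff_symmetric hcomm]
    intro v w
    rw [ContinuousLinearMap.coe_coe, ← hT'mul, ← hT'mul]
    exact second_derivative_symmetric_of_eventually
      (Filter.mem_of_superset (hUo.mem_nhds hp) hφ) hT' v w
  · intro hA
    have := FiniteDimensional.complete ℝ A
    have hd : ∀ p ∈ U, ∃ T' : A →L[ℝ] A →L[ℝ] A,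
        HasFDerivAt (RealNormAlgebra.starForm f (RealNormAlgebra.dZeta A)) T' p ∧
          ∀ v w, T' v w = T' w v := by
      intro p hp
      obtain ⟨T, hT, hfT⟩ := hA p hp
      obtain ⟨T', hT', hT'mul⟩ := RealNormAlgebra.hasFDerivAt_starForm_dZeta hfT
      refine ⟨T', hT', fun v w ↦ ?_⟩
      rw [hT'mul, hT'mul]
      exact (RealNormAlgebra.mem_rightLinearMaps_iff_symmetric hcomm T).1 hT v w
    refine exists_hasFDerivAt_of_isSimplyConnected hUo hU (fun p hp ↦ ?_) fun p hp v w ↦ ?_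
    · obtain ⟨T', hT', -⟩ := hd p hp
      exact hT'.differentiableAt.differentiableWithinAt
    · obtain ⟨T', hT', hsymm⟩ := hd p hp
      rw [hT'.fderiv, hsymm]
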